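/- Let $\mathbb D$ be the open unit disc and let $A(\mathbb D)$ be the disk algebra, i.e. the algebra, with the sup norm, of continuous functions on $\overline{\mathbb D}$ that are holomorphic on $\mathbb D$. Let $$\varphi(z)=u\prod_{i=1}^{N}\frac{z-a_i}{1-\bar a_i z},\qquad |u|=1,\quad |a_i|<1,\quad N\ge 2,$$ be a non-trivial finite Blaschke product, and let $\alpha(f)=f\circ\varphi$ be the induced endomorphism of $A(\mathbb D)$. Let $\mathcal P$ be the algebra of formal polynomials $\sum_k U^k f_k$ with $f_k\in A(\mathbb D)$ and the commutation relation $fU=U\alpha(f)$. A pair $(A,T)$ of contractions on a complex Hilbert space with $AT=T\varphi(A)$ defines a representation $\sum_k U^kf_k\mapsto\sum_k T^kf_k(A)$ of $\mathcal P$, where $f\mapsto f(A)$ is the unique contractive unital representation of $A(\mathbb D)$ that sends the coordinate function $z$ to $A$. The norm of an element of $\mathcal P$ is the supremum of the norms of its images under all these representations, and the semicrossed product $A(\mathbb D)\times_\alpha\mathbb Z^+$ is the completion of $\mathcal P$ in this norm. Suppose that $\varphi$ is elliptic, i.e. that there is $z\in\mathbb D$ with $\varphi(z)=z$. Then $A(\mathbb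 D)\times_\alpha\mathbb Z^+$ has no nonzero quasinilpotent elements: if $F\in A(\mathbb D)\times_\alpha\mathbb Z^+$ and $\lim_{n\to\infty}\|F^n\|^{1/n}=0$, then $F=0$. -/

import Mathlib

noncomputable section

/-- The disk algebra `A(𝔻)`: the continuous functions on the closed unit disc that are holomorphic
on the open unit disc. As a subalgebra of `C(closedBall 0 1, ℂ)` it carries the sup norm. -/
def diskAlgebra : Subalgebra ℂ C(Metric.closedBall (0 : ℂ) 1, ℂ) where
  carrier := {f | ∃ g : ℂ → ℂ, DifferentiableOn ℂ g (Metric.ball 0 1) ∧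
    ∀ z : Metric.closedBall (0 : ℂ) 1, f z = g z}
  mul_mem' := by
    rintro f₁ f₂ ⟨g₁, h₁, e₁⟩ ⟨g₂, h₂, e₂⟩
    exact ⟨fun z => g₁ z * g₂ z, h₁.mul h₂, fun z => by simp [e₁, e₂]⟩
  add_mem' := by
    rintro f₁ f₂ ⟨g₁, h₁, e₁⟩ ⟨g₂, h₂, e₂⟩
    exact ⟨fun z => g₁ z + g₂ z, h₁.add h₂, fun z => by simp [e₁, e₂]⟩
  algebraMap_mem' := fun c =>
    ⟨fun _ => c, differentiableOn_const c, fun z => by simp⟩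

namespace diskAlgebra

/-- The coordinate function `z` of the disk algebra. -/
def coord : diskAlgebra :=
  ⟨⟨fun z => z, continuous_subtype_val⟩, fun z => z, differentiableOn_id, fun _ => rfl⟩

theorem norm_le_of_forall {f : diskAlgebra} {C : ℝ} (hC : 0 ≤ C)
    (h : ∀ z : Metric.closedBall (0 : ℂ) 1, ‖f.1 z‖ ≤ C) : ‖f‖ ≤ C :=
  (ContinuousMap.norm_le f.1 hC).mpr h

/-- The polynomials in `z` are dense in the disk algebra. -/
theorem mem_of_isClosed (S : Subalgebra ℂ diskAlgebra) (hS : IsClosed (S : Set diskAlgebra))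
    (hz : coord ∈ S) (f : diskAlgebra) : f ∈ S := by
  change f ∈ (S : Set diskAlgebra)
  rw [← hS.closure_eq, Metric.mem_closure_iff]
  intro ε hε
  obtain ⟨g, hg, e⟩ := f.2
  obtain ⟨δ, hδ, hf⟩ := Metric.uniformContinuous_iff.mp
    (CompactSpace.uniformContinuous_of_continuous f.1.continuous) (ε / 4) (by positivity)
  obtain ⟨η, hη, hη1⟩ : ∃ η : ℝ, 0 < η ∧ η < min δ 1 := exists_between (lt_min hδ one_pos)
  have hηδ := hη1.trans_le (min_le_left _ _)
  replace hη1 := hη1.trans_le (min_le_right _ _)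
  let R : NNReal := ⟨1 - η / 4, by linarith⟩
  let R' : NNReal := ⟨1 - η / 2, by linarith⟩
  have hRR' : (R' : ENNReal) < R := by
    rw [ENNReal.coe_lt_coe, ← NNReal.coe_lt_coe]
    change 1 - η / 2 < 1 - η / 4
    linarith
  have hR0 : 0 < R := by
    rw [← NNReal.coe_lt_coe]
    change 0 < 1 - η / 4
    linarith
  have hps := (hg.mono (Metric.closedBall_subset_ball (x := (0 : ℂ)) (ε₁ := R) (ε₂ := 1)
    (show 1 - η / 4 < 1 by linarith))).hasFPowerSeriesOnBall hR0
  obtain ⟨n, hn⟩ := (Metric.tendstoUniformlyOn_iff.mp (hps.tendstoUniformlyOn hRR')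
    (ε / 4) (by positivity)).exists
  set q := cauchyPowerSeries g 0 R
  refine ⟨∑ k ∈ Finset.range n, q.coeff k • (((1 - η : ℝ) : ℂ) • coord) ^ k,
    S.sum_mem fun k _ => S.smul_mem (S.pow_mem (S.smul_mem hz _) _) _, ?_⟩
  rw [dist_eq_norm]
  refine (norm_le_of_forall (C := ε / 2) (by positivity) fun z => ?_).trans_lt (by linarith)
  have hz1 : ‖(z : ℂ)‖ ≤ 1 := mem_closedBall_zero_iff.mp z.2
  have hr : ‖((1 - η : ℝ) : ℂ)‖ = 1 - η := by
    rw [Complex.norm_real, Real.norm_eq_abs, abs_of_pos (by linarith)]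
  have hw : ‖((1 - η : ℝ) : ℂ) * z‖ ≤ 1 - η := by
    rw [norm_mul, hr]; nlinarith [norm_nonneg (z : ℂ)]
  let w : Metric.closedBall (0 : ℂ) 1 :=
    ⟨((1 - η : ℝ) : ℂ) * z, mem_closedBall_zero_iff.mpr (by linarith)⟩
  have h1 : dist (f.1 z) (f.1 w) < ε / 4 := by
    refine hf ?_
    rw [Subtype.dist_eq, dist_eq_norm]
    have : (z : ℂ) - ((1 - η : ℝ) : ℂ) * z = (η : ℂ) * z := by push_cast; ring
    change ‖(z : ℂ) - ((1 - η : ℝ) : ℂ) * z‖ < δ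
    rw [this, norm_mul, Complex.norm_real, Real.norm_eq_abs, abs_of_pos hη]
    nlinarith [norm_nonneg (z : ℂ)]
  have h2 := hn (w : ℂ) (mem_ball_zero_iff.mpr (hw.trans_lt (show 1 - η < 1 - η / 2 by linarith)))
  rw [zero_add, ← e w] at h2
  have h3 : (f - ∑ k ∈ Finset.range n, q.coeff k • (((1 - η : ℝ) : ℂ) • coord) ^ k).1 z
      = f.1 z - q.partialSum n w := by
    have : ∀ k, (((q.coeff k • (((1 - η : ℝ) : ℂ) • coord) ^ k : diskAlgebra) :
        C(Metric.closedBall (0 : ℂ) 1, ℂ)) z) = q k fun _ => (w : ℂ) := by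
      intro k
      rw [FormalMultilinearSeries.apply_eq_pow_smul_coeff, smul_eq_mul, mul_comm]
      rfl
    simp only [FormalMultilinearSeries.partialSum, ← this]
    simp
  rw [h3, ← dist_eq_norm]
  linarith [dist_triangle (f.1 z) (f.1 w) (q.partialSum n w)]

end diskAlgebra

/-- The data of a non-constant finite Blaschke product
`φ(z) = u ∏ i, (z - a i) / (1 - conj (a i) z)` with `N ≥ 1` factors. -/
structure FiniteBlaschke where
  /-- the number of factors -/
  N : ℕ
  N_pos : 0 < N
  u : ℂ
  norm_u : ‖u‖ = 1
  a : Fin N → ℂ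
  norm_a_lt : ∀ i, ‖a i‖ < 1

namespace FiniteBlaschke

/-- The function `φ` itself. -/
def toFun (φ : FiniteBlaschke) (z : ℂ) : ℂ :=
  φ.u * ∏ i, (z - φ.a i) / (1 - (starRingEnd ℂ) (φ.a i) * z)

/-- A finite Blaschke product is elliptic if it has a fixed point in the open unit disc. -/
def IsElliptic (φ : FiniteBlaschke) : Prop :=
  ∃ z : ℂ, ‖z‖ < 1 ∧ φ.toFun z = z

theorem denom_ne_zero {a z : ℂ} (ha : ‖a‖ < 1) (hz : ‖z‖ ≤ 1) :
    1 - (starRingEnd ℂ) a * z ≠ 0 := by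
  intro h
  have h1 : (starRingEnd ℂ) a * z = 1 := (sub_eq_zero.mp h).symm
  have h2 : ‖a‖ * ‖z‖ = 1 := by
    have := congrArg norm h1
    simpa using this
  nlinarith [norm_nonneg a, norm_nonneg z]

theorem normSq_identity (a z : ℂ) :
    ‖1 - (starRingEnd ℂ) a * z‖ ^ 2 - ‖z - a‖ ^ 2 = (1 - ‖a‖ ^ 2) * (1 - ‖z‖ ^ 2) := by
  simp only [← Complex.normSq_eq_norm_sq, Complex.normSq_apply, Complex.sub_re, Complex.sub_im,
    Complex.mul_re, Complex.mul_im, Complex.conj_re, Complex.conj_im, Complex.one_re,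
    Complex.one_im]
  ring

theorem norm_factor_le {a z : ℂ} (ha : ‖a‖ < 1) (hz : ‖z‖ ≤ 1) :
    ‖(z - a) / (1 - (starRingEnd ℂ) a * z)‖ ≤ 1 := by
  rw [norm_div, div_le_one (norm_pos_iff.mpr (denom_ne_zero ha hz))]
  refine abs_le_of_sq_le_sq' ?_ (norm_nonneg _) |>.2
  have h1 : 0 ≤ (1 - ‖a‖ ^ 2) * (1 - ‖z‖ ^ 2) :=
    mul_nonneg (by nlinarith [norm_nonneg a]) (by nlinarith [norm_nonneg z])
  linarith [normSq_identity a z]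

theorem norm_factor_lt {a z : ℂ} (ha : ‖a‖ < 1) (hz : ‖z‖ < 1) :
    ‖(z - a) / (1 - (starRingEnd ℂ) a * z)‖ < 1 := by
  rw [norm_div, div_lt_one (norm_pos_iff.mpr (denom_ne_zero ha hz.le))]
  refine abs_lt_of_sq_lt_sq' ?_ (norm_nonneg _) |>.2
  have h1 : 0 < (1 - ‖a‖ ^ 2) * (1 - ‖z‖ ^ 2) :=
    mul_pos (by nlinarith [norm_nonneg a]) (by nlinarith [norm_nonneg z])
  linarith [normSq_identity a z]

theorem norm_toFun_le (φ : FiniteBlaschke) {z : ℂ} (hz : ‖z‖ ≤ 1) : ‖φ.toFun z‖ ≤ 1 := by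
  rw [toFun, norm_mul, φ.norm_u, one_mul, norm_prod]
  exact Finset.prod_le_one (fun _ _ => norm_nonneg _)
    (fun i _ => norm_factor_le (φ.norm_a_lt i) hz)

theorem norm_toFun_lt (φ : FiniteBlaschke) {z : ℂ} (hz : ‖z‖ < 1) : ‖φ.toFun z‖ < 1 := by
  rw [toFun, norm_mul, φ.norm_u, one_mul, norm_prod,
    ← Finset.mul_prod_erase Finset.univ _ (Finset.mem_univ (⟨0, φ.N_pos⟩ : Fin φ.N))]
  exact mul_lt_one_of_nonneg_of_lt_one_left (norm_nonneg _)
    (norm_factor_lt (φ.norm_a_lt _) hz)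
    (Finset.prod_le_one (fun _ _ => norm_nonneg _)
      (fun i _ => norm_factor_le (φ.norm_a_lt i) hz.le))

theorem differentiableAt_toFun (φ : FiniteBlaschke) {z : ℂ} (hz : ‖z‖ ≤ 1) :
    DifferentiableAt ℂ φ.toFun z := by
  unfold toFun
  refine DifferentiableAt.const_mul (DifferentiableAt.fun_finsetProd fun i _ => ?_) _
  exact DifferentiableAt.div (by fun_prop) (by fun_prop) (denom_ne_zero (φ.norm_a_lt i) hz)

/-- `φ` as a continuous self-map of the closed unit disc. -/
def selfMap (φ : FiniteBlaschke) : C(Metric.closedBall (0 : ℂ) 1, Metric.closedBall (0 : ℂ) 1) where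
  toFun z := ⟨φ.toFun z, by
    have hz := z.2
    rw [mem_closedBall_zero_iff] at hz ⊢
    exact φ.norm_toFun_le hz⟩
  continuous_toFun := by
    refine Continuous.subtype_mk (continuous_iff_continuousAt.mpr fun z => ?_) _
    exact ContinuousAt.comp (g := φ.toFun)
      (φ.differentiableAt_toFun (mem_closedBall_zero_iff.mp z.2)).continuousAt
      continuous_subtype_val.continuousAt

/-- The endomorphism `α(f) = f ∘ φ` of the disk algebra. -/
def endo (φ : FiniteBlaschke) : diskAlgebra →ₐ[ℂ] diskAlgebra where
  toFun f := ⟨(f : C(Metric.closedBall (0 : ℂ) 1, ℂ)).comp φ.selfMap, by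
    obtain ⟨g, hg, e⟩ := f.2
    refine ⟨g ∘ φ.toFun, hg.comp (fun z hz => ?_) (fun z hz => ?_), fun z => e _⟩
    · exact (φ.differentiableAt_toFun (mem_ball_zero_iff.mp hz).le).differentiableWithinAt
    · exact mem_ball_zero_iff.mpr (φ.norm_toFun_lt (mem_ball_zero_iff.mp hz))⟩
  map_one' := rfl
  map_mul' _ _ := rfl
  map_zero' := rfl
  map_add' _ _ := rfl
  commutes' _ := rfl

theorem norm_endo_le (φ : FiniteBlaschke) (f : diskAlgebra) : ‖φ.endo f‖ ≤ ‖f‖ :=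
  diskAlgebra.norm_le_of_forall (norm_nonneg f) fun z => f.1.norm_coe_le_norm (φ.selfMap z)

theorem continuous_endo (φ : FiniteBlaschke) : Continuous φ.endo :=
  AddMonoidHomClass.continuous_of_bound φ.endo 1 fun f => by
    rw [one_mul]; exact φ.norm_endo_le f

/-- `φ` itself, as an element of the disk algebra. -/
def toDiskAlgebra (φ : FiniteBlaschke) : diskAlgebra :=
  ⟨⟨fun z => φ.toFun z, continuous_subtype_val.comp φ.selfMap.continuous⟩, φ.toFun,
    fun _ hz => (φ.differentiableAt_toFun (mem_ball_zero_iff.mp hz).le).differentiableWithinAt,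
    fun _ => rfl⟩

end FiniteBlaschke

/-- The algebra of formal polynomials `∑ U ^ k f_k` with coefficients `f_k ∈ A(𝔻)`, subject to the
commutation relation `f U = U α(f)`, where `α(f) = f ∘ φ`. The element `∑ U ^ k f_k` is stored as
the finitely supported function `k ↦ f_k`. -/
def CovPoly (_φ : FiniteBlaschke) : Type := ℕ →₀ diskAlgebra

namespace CovPoly

variable {φ : FiniteBlaschke}

instance : AddCommGroup (CovPoly φ) := inferInstanceAs (AddCommGroup (ℕ →₀ diskAlgebra))

instance : Module ℂ (CovPoly φ) := inferInstanceAs (Module ℂ (ℕ →₀ diskAlgebra))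

/-- The monomial `U ^ k f`, as an additive map of `f`. -/
def mono (φ : FiniteBlaschke) (k : ℕ) : diskAlgebra →+ CovPoly φ :=
  Finsupp.singleAddHom k

/-- The additive map out of `CovPoly φ` with prescribed values on monomials. -/
def lift {M : Type*} [AddCommMonoid M] (h : ℕ → diskAlgebra →+ M) : CovPoly φ →+ M :=
  Finsupp.liftAddHom h

@[simp] theorem lift_mono {M : Type*} [AddCommMonoid M] (h : ℕ → diskAlgebra →+ M) (k : ℕ)
    (f : diskAlgebra) : lift h (mono φ k f) = h k f :=
  Finsupp.liftAddHom_apply_single h k f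

theorem addHom_ext' {M : Type*} [AddCommMonoid M] {h₁ h₂ : CovPoly φ →+ M}
    (h : ∀ k f, h₁ (mono φ k f) = h₂ (mono φ k f)) : h₁ = h₂ :=
  Finsupp.addHom_ext h

theorem smul_mono (c : ℂ) (k : ℕ) (f : diskAlgebra) : c • mono φ k f = mono φ k (c • f) :=
  Finsupp.smul_single c k f

/-- Multiplication, as a biadditive map: `(U ^ i f) (U ^ j g) = U ^ (i + j) (α ^ j (f) g)`. -/
def mulHom (φ : FiniteBlaschke) : CovPoly φ →+ CovPoly φ →+ CovPoly φ :=
  lift fun i => AddMonoidHom.flip (lift fun j =>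
    AddMonoidHom.mk' (fun g => (mono φ (i + j)).comp
      ((AddMonoidHom.mulRight g).comp ((φ.endo ^ j : diskAlgebra →ₐ[ℂ] diskAlgebra) :
        diskAlgebra →+ diskAlgebra)))
      (fun g₁ g₂ => by ext1 f; simp [mul_add]))

instance : Mul (CovPoly φ) := ⟨fun p q => mulHom φ p q⟩

instance : One (CovPoly φ) := ⟨mono φ 0 1⟩

theorem mul_eq (p q : CovPoly φ) : p * q = mulHom φ p q := rfl

theorem one_eq : (1 : CovPoly φ) = mono φ 0 1 := rfl

theorem mono_mul_mono (i j : ℕ) (f g : diskAlgebra) :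
    mono φ i f * mono φ j g = mono φ (i + j) ((φ.endo ^ j) f * g) := by
  simp [mul_eq, mulHom]

theorem induction {P : CovPoly φ → Prop} (p : CovPoly φ) (h0 : P 0)
    (hadd : ∀ p q, P p → P q → P (p + q)) (hm : ∀ k f, P (mono φ k f)) : P p :=
  Finsupp.induction_linear p h0 hadd hm

protected theorem left_distrib (p q r : CovPoly φ) : p * (q + r) = p * q + p * r := by
  simp [mul_eq]

protected theorem right_distrib (p q r : CovPoly φ) : (p + q) * r = p * r + q * r := by
  simp [mul_eq]

protected theorem zero_mul' (p : CovPoly φ) : 0 * p = 0 := by simp [mul_eq]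

protected theorem mul_zero' (p : CovPoly φ) : p * 0 = 0 := by simp [mul_eq]

protected theorem mul_assoc' (p q r : CovPoly φ) : p * q * r = p * (q * r) := by
  induction p using CovPoly.induction with
  | h0 => simp [CovPoly.zero_mul']
  | hadd p₁ p₂ h₁ h₂ => simp [CovPoly.right_distrib, h₁, h₂]
  | hm i f =>
    induction q using CovPoly.induction with
    | h0 => simp [CovPoly.zero_mul', CovPoly.mul_zero']
    | hadd q₁ q₂ h₁ h₂ => simp [CovPoly.right_distrib, CovPoly.left_distrib, h₁, h₂]
    | hm j g =>
      induction r using CovPoly.induction with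
      | h0 => simp [CovPoly.mul_zero']
      | hadd r₁ r₂ h₁ h₂ => simp [CovPoly.left_distrib, h₁, h₂]
      | hm k h =>
        simp only [mono_mul_mono, map_mul, add_assoc, mul_assoc]
        rw [add_comm j k, pow_add, AlgHom.mul_apply, add_comm k j]

instance : Ring (CovPoly φ) where
  __ := (inferInstance : AddCommGroup (CovPoly φ))
  mul := (· * ·)
  one := 1
  left_distrib := CovPoly.left_distrib
  right_distrib := CovPoly.right_distrib
  zero_mul := CovPoly.zero_mul'
  mul_zero := CovPoly.mul_zero'
  mul_assoc := CovPoly.mul_assoc'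
  one_mul p := by
    induction p using CovPoly.induction with
    | h0 => exact CovPoly.mul_zero' _
    | hadd p₁ p₂ h₁ h₂ => rw [CovPoly.left_distrib, h₁, h₂]
    | hm i f => rw [one_eq, mono_mul_mono, map_one, one_mul, zero_add]
  mul_one p := by
    induction p using CovPoly.induction with
    | h0 => exact CovPoly.zero_mul' _
    | hadd p₁ p₂ h₁ h₂ => rw [CovPoly.right_distrib, h₁, h₂]
    | hm i f => rw [one_eq, mono_mul_mono, mul_one, pow_zero, add_zero]; rfl

protected theorem smul_mul_assoc' (c : ℂ) (p q : CovPoly φ) : c • p * q = c • (p * q) := by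
  induction p using CovPoly.induction with
  | h0 => simp
  | hadd p₁ p₂ h₁ h₂ => simp [add_mul, h₁, h₂]
  | hm i f =>
    induction q using CovPoly.induction with
    | h0 => simp
    | hadd q₁ q₂ h₁ h₂ => simp [mul_add, h₁, h₂]
    | hm j g => simp only [smul_mono, mono_mul_mono, map_smul, smul_mul_assoc]

protected theorem mul_smul_comm' (c : ℂ) (p q : CovPoly φ) : p * c • q = c • (p * q) := by
  induction p using CovPoly.induction with
  | h0 => simp
  | hadd p₁ p₂ h₁ h₂ => simp [add_mul, h₁, h₂]
  | hm i f =>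
    induction q using CovPoly.induction with
    | h0 => simp
    | hadd q₁ q₂ h₁ h₂ => simp [mul_add, h₁, h₂]
    | hm j g => simp only [smul_mono, mono_mul_mono, mul_smul_comm]

instance : Algebra ℂ (CovPoly φ) :=
  Algebra.ofModule CovPoly.smul_mul_assoc' CovPoly.mul_smul_comm'

end CovPoly

/-- A pair `(A, T)` of contractions on a Hilbert space `H` with `A T = T φ(A)`. The map `ρ` is the
disk algebra functional calculus `f ↦ f(A)`: the unital contractive representation of `A(𝔻)` with
`ρ(z) = A`. By von Neumann's inequality and the density of polynomials in `A(𝔻)`, every contraction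
`A` has exactly one such `ρ`, so that `ρ` is not an additional choice. -/
structure CovariantPair (φ : FiniteBlaschke) (H : Type*) [NormedAddCommGroup H]
    [InnerProductSpace ℂ H] [CompleteSpace H] where
  A : H →L[ℂ] H
  T : H →L[ℂ] H
  norm_A_le : ‖A‖ ≤ 1
  norm_T_le : ‖T‖ ≤ 1
  ρ : diskAlgebra →ₐ[ℂ] (H →L[ℂ] H)
  norm_ρ_le : ∀ f, ‖ρ f‖ ≤ ‖f‖
  ρ_coord : ρ diskAlgebra.coord = A
  covariant : A * T = T * ρ φ.toDiskAlgebra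

namespace CovariantPair

variable {φ : FiniteBlaschke} {H : Type*} [NormedAddCommGroup H] [InnerProductSpace ℂ H]
  [CompleteSpace H]

theorem continuous_ρ (R : CovariantPair φ H) : Continuous R.ρ :=
  AddMonoidHomClass.continuous_of_bound R.ρ 1 fun f => by
    rw [one_mul]; exact R.norm_ρ_le f

/-- The relation `A T = T φ(A)` implies `f(A) T = T (f ∘ φ)(A)` for all `f` in the disk algebra. -/
theorem covariant_all (R : CovariantPair φ H) (f : diskAlgebra) :
    R.ρ f * R.T = R.T * R.ρ (φ.endo f) := by
  let S : Subalgebra ℂ diskAlgebra :=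
    { carrier := {f | R.ρ f * R.T = R.T * R.ρ (φ.endo f)}
      mul_mem' := by
        intro f g hf hg
        simp only [Set.mem_ofPred_eq] at hf hg ⊢
        rw [map_mul, map_mul, map_mul, mul_assoc, hg, ← mul_assoc, hf, mul_assoc]
      add_mem' := by
        intro f g hf hg
        simp only [Set.mem_ofPred_eq] at hf hg ⊢
        rw [map_add, map_add, map_add, add_mul, mul_add, hf, hg]
      algebraMap_mem' := by
        intro c
        simp only [Set.mem_ofPred_eq, AlgHom.commutes]
        exact Algebra.commutes c R.T }
  refine diskAlgebra.mem_of_isClosed S (isClosed_eq (R.continuous_ρ.mul continuous_const)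
    (continuous_const.mul (R.continuous_ρ.comp φ.continuous_endo))) ?_ f
  change R.ρ diskAlgebra.coord * R.T = R.T * R.ρ (φ.endo diskAlgebra.coord)
  rw [R.ρ_coord]
  exact R.covariant

theorem covariant_pow (R : CovariantPair φ H) (f : diskAlgebra) (j : ℕ) :
    R.ρ f * R.T ^ j = R.T ^ j * R.ρ ((φ.endo ^ j) f) := by
  induction j generalizing f with
  | zero => simp
  | succ j ih =>
    rw [pow_succ', ← mul_assoc, R.covariant_all, mul_assoc, ih, pow_succ φ.endo, AlgHom.mul_apply,
      mul_assoc]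

/-- The representation `ρ × T` of the formal polynomials: `∑ U ^ k f_k ↦ ∑ T ^ k ρ(f_k)`. -/
def rep (R : CovariantPair φ H) : CovPoly φ →+ (H →L[ℂ] H) :=
  CovPoly.lift fun k => (AddMonoidHom.mulLeft (R.T ^ k)).comp
    (R.ρ : diskAlgebra →+ (H →L[ℂ] H))

@[simp] theorem rep_mono (R : CovariantPair φ H) (k : ℕ) (f : diskAlgebra) :
    R.rep (CovPoly.mono φ k f) = R.T ^ k * R.ρ f := by
  simp [rep]

theorem rep_mul (R : CovariantPair φ H) (p q : CovPoly φ) :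
    R.rep (p * q) = R.rep p * R.rep q := by
  induction p using CovPoly.induction with
  | h0 => simp
  | hadd p₁ p₂ h₁ h₂ => simp [add_mul, h₁, h₂]
  | hm i f =>
    induction q using CovPoly.induction with
    | h0 => simp
    | hadd q₁ q₂ h₁ h₂ => simp [mul_add, h₁, h₂]
    | hm j g =>
      rw [CovPoly.mono_mul_mono, rep_mono, rep_mono, rep_mono, pow_add, map_mul, mul_assoc,
        mul_assoc, ← mul_assoc (R.ρ f), R.covariant_pow, mul_assoc]

theorem rep_smul (R : CovariantPair φ H) (c : ℂ) (p : CovPoly φ) :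
    R.rep (c • p) = c • R.rep p := by
  induction p using CovPoly.induction with
  | h0 => simp
  | hadd p₁ p₂ h₁ h₂ => simp [h₁, h₂]
  | hm i f => rw [CovPoly.smul_mono, rep_mono, rep_mono, map_smul, mul_smul_comm]

theorem norm_rep_mono_le (R : CovariantPair φ H) (k : ℕ) (f : diskAlgebra) :
    ‖R.rep (CovPoly.mono φ k f)‖ ≤ ‖f‖ := by
  rw [rep_mono]
  have hT : ∀ m : ℕ, ‖R.T ^ m‖ ≤ 1 := by
    intro m
    induction m with
    | zero => exact ContinuousLinearMap.norm_id_le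
    | succ m ih =>
      rw [pow_succ]
      exact (norm_mul_le _ _).trans (mul_le_one₀ ih (norm_nonneg _) R.norm_T_le)
  calc ‖R.T ^ k * R.ρ f‖ ≤ ‖R.T ^ k‖ * ‖R.ρ f‖ := norm_mul_le _ _
    _ ≤ 1 * ‖f‖ := mul_le_mul (hT k) (R.norm_ρ_le f) (norm_nonneg _) zero_le_one
    _ = ‖f‖ := one_mul _

end CovariantPair

namespace CovPoly

variable {φ : FiniteBlaschke}

/-- The set of the numbers `‖(ρ × T)(p)‖`, over all Hilbert spaces and all pairs of contractions
`(A, T)` with `A T = T φ(A)`. Restricting to Hilbert spaces in `Type` loses nothing, because the norm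
of an operator in the image of `ρ × T` is already attained on a separable reducing subspace. -/
def repNorms (p : CovPoly φ) : Set ℝ :=
  {r | ∃ (H : Type) (_ : NormedAddCommGroup H) (_ : InnerProductSpace ℂ H) (_ : CompleteSpace H)
    (R : CovariantPair φ H), r = ‖R.rep p‖}

/-- The norm of a formal polynomial: the supremum of the norms of its images. -/
instance : Norm (CovPoly φ) := ⟨fun p => sSup (repNorms p)⟩

theorem norm_def (p : CovPoly φ) : ‖p‖ = sSup (repNorms p) := rfl

theorem bddAbove_repNorms (p : CovPoly φ) : BddAbove (repNorms p) := by
  induction p using CovPoly.induction with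
  | h0 =>
    refine ⟨0, ?_⟩
    rintro _ ⟨H, _, _, _, R, rfl⟩
    simp
  | hadd p q hp hq =>
    obtain ⟨b, hb⟩ := hp
    obtain ⟨c, hc⟩ := hq
    refine ⟨b + c, ?_⟩
    rintro _ ⟨H, i₁, i₂, i₃, R, rfl⟩
    rw [map_add]
    exact (norm_add_le _ _).trans
      (add_le_add (hb ⟨H, i₁, i₂, i₃, R, rfl⟩) (hc ⟨H, i₁, i₂, i₃, R, rfl⟩))
  | hm k f =>
    refine ⟨‖f‖, ?_⟩
    rintro _ ⟨H, _, _, _, R, rfl⟩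
    exact R.norm_rep_mono_le k f

theorem norm_rep_le (p : CovPoly φ) {H : Type} [i₁ : NormedAddCommGroup H]
    [i₂ : InnerProductSpace ℂ H] [i₃ : CompleteSpace H] (R : CovariantPair φ H) :
    ‖R.rep p‖ ≤ ‖p‖ :=
  le_csSup (bddAbove_repNorms p) ⟨H, i₁, i₂, i₃, R, rfl⟩

protected theorem norm_nonneg' (p : CovPoly φ) : 0 ≤ ‖p‖ :=
  Real.sSup_nonneg (by rintro _ ⟨H, _, _, _, R, rfl⟩; exact norm_nonneg _)

protected theorem norm_le {p : CovPoly φ} {C : ℝ} (hC : 0 ≤ C)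
    (h : ∀ (H : Type) [NormedAddCommGroup H] [InnerProductSpace ℂ H] [CompleteSpace H]
      (R : CovariantPair φ H), ‖R.rep p‖ ≤ C) : ‖p‖ ≤ C :=
  Real.sSup_le (by rintro _ ⟨H, _, _, _, R, rfl⟩; exact h H R) hC

instance : SeminormedRing (CovPoly φ) :=
  { (inferInstance : Ring (CovPoly φ)),
    SeminormedAddCommGroup.ofCore (𝕜 := ℂ)
      { norm_nonneg := CovPoly.norm_nonneg'
        norm_smul := by
          have key : ∀ (c : ℂ) (p : CovPoly φ), ‖c • p‖ ≤ ‖c‖ * ‖p‖ := fun c p =>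
            CovPoly.norm_le (mul_nonneg (norm_nonneg c) p.norm_nonneg') fun H _ _ _ R => by
              rw [R.rep_smul, norm_smul]
              exact mul_le_mul_of_nonneg_left (norm_rep_le p R) (norm_nonneg c)
          intro c p
          refine le_antisymm (key c p) ?_
          rcases eq_or_ne c 0 with rfl | hc
          · simpa using CovPoly.norm_nonneg' ((0 : ℂ) • p)
          · have h := key c⁻¹ (c • p)
            rw [inv_smul_smul₀ hc, norm_inv] at h
            rwa [← le_inv_mul_iff₀ (norm_pos_iff.mpr hc)]
        norm_triangle := fun p q =>
          CovPoly.norm_le (add_nonneg p.norm_nonneg' q.norm_nonneg') fun H _ _ _ R => by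
            rw [map_add]
            exact (norm_add_le _ _).trans (add_le_add (norm_rep_le p R) (norm_rep_le q R)) } with
    norm_mul_le := fun p q =>
      CovPoly.norm_le (mul_nonneg p.norm_nonneg' q.norm_nonneg') fun H _ _ _ R => by
        rw [R.rep_mul]
        exact (norm_mul_le _ _).trans
          (mul_le_mul (norm_rep_le p R) (norm_rep_le q R) (norm_nonneg _) p.norm_nonneg') }

instance : NormedSpace ℂ (CovPoly φ) where
  norm_smul_le c p :=
    CovPoly.norm_le (mul_nonneg (norm_nonneg c) p.norm_nonneg') fun H _ _ _ R => by
      rw [R.rep_smul, norm_smul]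
      exact mul_le_mul_of_nonneg_left (norm_rep_le p R) (norm_nonneg c)

end CovPoly

/-- The semicrossed product `A(𝔻) ×_α ℤ⁺`: the completion of the formal polynomials in the norm
above. It is a Banach algebra. -/
abbrev SemicrossedProduct (φ : FiniteBlaschke) : Type := UniformSpace.Completion (CovPoly φ)

/-- An element `x` of a normed ring is quasinilpotent if `lim ‖x ^ n‖ ^ (1 / n) = 0`. -/
def IsQuasinilpotent {B : Type*} [NormedRing B] (x : B) : Prop :=
  Filter.Tendsto (fun n : ℕ => ‖x ^ n‖ ^ (1 / (n : ℝ))) Filter.atTop (nhds 0)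

end

/-!
Evaluating the pair `(A, T)`, with `A` diagonal along a finite piece of an orbit of `φ` and `T` a
shift, at the first basis vector reads off the coefficients of a formal polynomial at a point, so
the Fourier coefficients `F ↦ f_k` extend to contractions of the semicrossed product. They
separate points by Abel summation: replacing `U` by `r U` gives a strongly continuous family of
contractions, `∑ U ^ k r ^ k f_k` is controlled by the `f_k` for `|r| < 1`, and it tends to `F` as
`r → 1`.

If `F ≠ 0` and `g = f_k` is its first nonzero coefficient, then the `n k`-th coefficient of `F ^ n`
is `∏_{i < n} g ∘ φ^{i k}`. Write `g = (z - z₀) ^ m h` with `h z₀ ≠ 0`, where `z₀` is the fixed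
point of `φ` in the disc. Since `φ` preserves the circle, there each factor `φ^{i k} - z₀` has
modulus at least `1 - |z₀|`, while by the maximum principle `∏ h ∘ φ^{i k}` reaches modulus at least
`|h z₀| ^ n` on the circle. Hence `‖F ^ n‖ ≥ c ^ n` with `c = (1 - |z₀|) ^ m |h z₀| > 0`.
-/

noncomputable section

open Filter Metric Topology
open Finset.HasAntidiagonal (antidiagonal mem_antidiagonal)

theorem not_isQuasinilpotent_of_pow_le_norm_pow {B : Type*} [NormedRing B] {x : B} {c : ℝ}
    (hc : 0 < c) (h : ∀ n : ℕ, c ^ n ≤ ‖x ^ n‖) : ¬ IsQuasinilpotent x := fun hx => by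
  refine absurd (ge_of_tendsto hx ?_) (not_le.mpr hc)
  filter_upwards [eventually_ne_atTop 0] with n hn
  calc c = (c ^ n) ^ (1 / (n : ℝ)) := by rw [one_div, Real.pow_rpow_inv_natCast hc.le hn]
    _ ≤ ‖x ^ n‖ ^ (1 / (n : ℝ)) := Real.rpow_le_rpow (by positivity) (h n) (by positivity)

/-- The truncated shift `e_i ↦ e_{i + 1}`, `e_n ↦ 0` on the Euclidean space with orthonormal basis
`e_0, …, e_n`; it serves as the operator `T` of a covariant pair. -/
def truncatedShift (𝕜 : Type*) [RCLike 𝕜] (n : ℕ) :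
    EuclideanSpace 𝕜 (Fin (n + 1)) →L[𝕜] EuclideanSpace 𝕜 (Fin (n + 1)) :=
  LinearMap.toContinuousLinearMap
    { toFun := fun v => WithLp.toLp 2 (Fin.cons 0 fun i => v i.castSucc)
      map_add' := fun v w => by ext i; cases i using Fin.cases <;> simp
      map_smul' := fun c v => by ext i; cases i using Fin.cases <;> simp }

section truncatedShift

variable {𝕜 : Type*} [RCLike 𝕜] {n : ℕ}

@[simp] theorem truncatedShift_apply_zero (v : EuclideanSpace 𝕜 (Fin (n + 1))) :
    truncatedShift 𝕜 n v 0 = 0 := rfl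

@[simp] theorem truncatedShift_apply_succ (v : EuclideanSpace 𝕜 (Fin (n + 1))) (i : Fin n) :
    truncatedShift 𝕜 n v i.succ = v i.castSucc := rfl

theorem norm_truncatedShift_le : ‖truncatedShift 𝕜 n‖ ≤ 1 := by
  refine ContinuousLinearMap.opNorm_le_bound _ zero_le_one fun v => ?_
  rw [one_mul]
  refine le_of_sq_le_sq ?_ (norm_nonneg v)
  rw [EuclideanSpace.norm_sq_eq, EuclideanSpace.norm_sq_eq, Fin.sum_univ_succ,
    Fin.sum_univ_castSucc (fun i => ‖v i‖ ^ 2)]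
  simp only [truncatedShift_apply_zero, truncatedShift_apply_succ, norm_zero]
  nlinarith [sq_nonneg ‖v (Fin.last n)‖]

theorem truncatedShift_pow_single_zero_apply (j : ℕ) (i : Fin (n + 1)) :
    ((truncatedShift 𝕜 n ^ j) (EuclideanSpace.single 0 1)) i = if (i : ℕ) = j then 1 else 0 := by
  induction j generalizing i with
  | zero =>
    rw [pow_zero, one_apply_eq_self, PiLp.single_apply]
    exact if_congr Fin.ext_iff rfl rfl
  | succ j ih =>
    rw [pow_succ', mul_apply_eq_comp]
    cases i using Fin.cases with
    | zero => simp
    | succ i =>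
      simp only [truncatedShift_apply_succ, ih, Fin.val_castSucc, Fin.val_succ,
        Nat.add_right_cancel_iff]

end truncatedShift

namespace diskAlgebra

theorem isClosed : IsClosed (diskAlgebra : Set C(closedBall (0 : ℂ) 1, ℂ)) := by
  refine isClosed_of_closure_subset fun f hf => ?_
  obtain ⟨u, hu, hlim⟩ := mem_closure_iff_seq_limit.mp hf
  choose g hg hug using hu
  let G : ℂ → ℂ := Function.extend Subtype.val f 0
  have hG (z : closedBall (0 : ℂ) 1) : f z = G z :=
    (Subtype.val_injective.extend_apply f 0 z).symm
  have hunif : TendstoUniformlyOn g G atTop (ball 0 1) := by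
    refine tendstoUniformlyOn_iff.mpr fun ε hε => ?_
    filter_upwards [Metric.tendsto_nhds.mp hlim ε hε] with n hn z hz
    rw [← hG ⟨z, ball_subset_closedBall hz⟩, ← hug n ⟨z, ball_subset_closedBall hz⟩, dist_comm]
    exact (ContinuousMap.dist_apply_le_dist _).trans_lt hn
  exact ⟨G, hunif.tendstoLocallyUniformlyOn.differentiableOn (.of_forall hg) isOpen_ball, hG⟩

instance : CompleteSpace diskAlgebra := diskAlgebra.isClosed.completeSpace_coe

theorem exists_diffContOnCl (f : diskAlgebra) :
    ∃ g : ℂ → ℂ, DiffContOnCl ℂ g (ball 0 1) ∧ ∀ z, f.1 z = g z := by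
  obtain ⟨g, hg, hfg⟩ := f.2
  refine ⟨g, .mk_ball hg ?_, hfg⟩
  rw [continuousOn_iff_continuous_domRestrict]
  exact f.1.continuous.congr hfg

/-- The element of the disk algebra given by a function on `ℂ` that is holomorphic on the open disc
and continuous up to the boundary. -/
def ofDiffContOnCl {g : ℂ → ℂ} (hg : DiffContOnCl ℂ g (ball 0 1)) : diskAlgebra :=
  ⟨⟨fun z => g z, continuousOn_iff_continuous_domRestrict.mp hg.continuousOn_ball⟩, g,
    hg.differentiableOn, fun _ => rfl⟩

theorem exists_norm_eq_one_norm_le (f : diskAlgebra) (w : closedBall (0 : ℂ) 1) :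
    ∃ ζ : closedBall (0 : ℂ) 1, ‖(ζ : ℂ)‖ = 1 ∧ ‖f.1 w‖ ≤ ‖f.1 ζ‖ := by
  obtain ⟨g, hg, hfg⟩ := exists_diffContOnCl f
  obtain ⟨ζ, hζ, hmax⟩ := Complex.exists_mem_frontier_isMaxOn_norm isBounded_ball
    (nonempty_ball.mpr one_pos) hg
  rw [frontier_ball 0 one_ne_zero] at hζ
  rw [closure_ball 0 one_ne_zero] at hmax
  refine ⟨⟨ζ, sphere_subset_closedBall hζ⟩, mem_sphere_zero_iff_norm.mp hζ, ?_⟩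
  rw [hfg, hfg]
  exact hmax w.2

theorem mul_norm_apply_le_norm_mul {f : diskAlgebra} {δ : ℝ}
    (hf : ∀ ζ : closedBall (0 : ℂ) 1, ‖(ζ : ℂ)‖ = 1 → δ ≤ ‖f.1 ζ‖) (g : diskAlgebra)
    (w : closedBall (0 : ℂ) 1) : δ * ‖g.1 w‖ ≤ ‖f * g‖ := by
  obtain ⟨ζ, hζ, hw⟩ := exists_norm_eq_one_norm_le g w
  calc δ * ‖g.1 w‖ ≤ ‖f.1 ζ‖ * ‖g.1 ζ‖ :=
        mul_le_mul (hf ζ hζ) hw (norm_nonneg _) (norm_nonneg _)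
    _ = ‖(f * g).1 ζ‖ := (norm_mul _ _).symm
    _ ≤ ‖f * g‖ := (f * g).1.norm_coe_le_norm ζ

variable {z₀ : closedBall (0 : ℂ) 1}

theorem eq_zero_of_eventually_eq_zero {f : diskAlgebra} {g : ℂ → ℂ}
    (hg : DiffContOnCl ℂ g (ball 0 1)) (hfg : ∀ z, f.1 z = g z) (hz₀ : ‖(z₀ : ℂ)‖ < 1)
    (h : ∀ᶠ z in 𝓝 (z₀ : ℂ), g z = 0) : f = 0 := by
  have hball : Set.EqOn g 0 (ball 0 1) :=
    (hg.differentiableOn.analyticOnNhd isOpen_ball).eqOn_zero_of_preconnected_of_eventuallyEq_zero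
      (convex_ball 0 1).isPreconnected (mem_ball_zero_iff.mpr hz₀) h
  have hclosedBall : Set.EqOn g 0 (closedBall 0 1) :=
    hball.of_subset_closure hg.continuousOn_ball continuousOn_const ball_subset_closedBall
      (closure_ball 0 one_ne_zero).ge
  ext z
  exact (hfg z).trans (hclosedBall z.2)

theorem coord_sub_pow_apply (c : ℂ) (m : ℕ) (z : closedBall (0 : ℂ) 1) :
    ((coord - algebraMap ℂ diskAlgebra c) ^ m).1 z = (z - c) ^ m := rfl

theorem coord_sub_dvd_iff (hz₀ : ‖(z₀ : ℂ)‖ < 1) {f : diskAlgebra} :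
    coord - algebraMap ℂ diskAlgebra z₀ ∣ f ↔ f.1 z₀ = 0 := by
  constructor
  · rintro ⟨h, rfl⟩
    exact mul_eq_zero_of_left (sub_self _) _
  · intro hf
    obtain ⟨g, hg, hfg⟩ := exists_diffContOnCl f
    have hball : ball (0 : ℂ) 1 ∈ 𝓝 (z₀ : ℂ) := isOpen_ball.mem_nhds (mem_ball_zero_iff.mpr hz₀)
    have hslope : DiffContOnCl ℂ (dslope g z₀) (ball 0 1) := .mk_ball
      ((Complex.differentiableOn_dslope hball).mpr hg.differentiableOn)
      ((continuousOn_dslope (mem_of_superset hball ball_subset_closedBall)).mpr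
        ⟨hg.continuousOn_ball, hg.differentiableOn.differentiableAt hball⟩)
    refine ⟨ofDiffContOnCl hslope, ?_⟩
    ext z
    calc f.1 z = g z - g z₀ := by rw [← hfg, ← hfg, hf, sub_zero]
      _ = ((z : ℂ) - z₀) • dslope g z₀ z := (sub_smul_dslope g z₀ z).symm

theorem finiteMultiplicity_coord_sub (hz₀ : ‖(z₀ : ℂ)‖ < 1) {f : diskAlgebra} (hf : f ≠ 0) :
    FiniteMultiplicity (coord - algebraMap ℂ diskAlgebra z₀) f := by
  by_contra hinf
  obtain ⟨g, hg, hfg⟩ := exists_diffContOnCl f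
  have hball : ball (0 : ℂ) 1 ∈ 𝓝 (z₀ : ℂ) := isOpen_ball.mem_nhds (mem_ball_zero_iff.mpr hz₀)
  refine hf (eq_zero_of_eventually_eq_zero hg hfg hz₀ <| analyticOrderAt_eq_top.mp ?_)
  refine ENat.eq_top_iff_forall_ge.mpr fun n => ?_
  obtain ⟨h, hfh⟩ := (FiniteMultiplicity.not_iff_forall.mp hinf) n
  obtain ⟨k, hk, hhk⟩ := exists_diffContOnCl h
  refine (natCast_le_analyticOrderAt (hg.differentiableOn.analyticAt hball)).mpr
    ⟨k, hk.differentiableOn.analyticAt hball, ?_⟩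
  filter_upwards [hball] with z hz
  let w : closedBall (0 : ℂ) 1 := ⟨z, ball_subset_closedBall hz⟩
  calc g z = f.1 w := (hfg w).symm
    _ = ((coord - algebraMap ℂ diskAlgebra z₀) ^ n * h).1 w := by rw [hfh]
    _ = (z - z₀) ^ n * h.1 w := congrArg (· * h.1 w) (coord_sub_pow_apply _ n w)
    _ = (z - z₀) ^ n • k z := by rw [hhk, smul_eq_mul]

theorem exists_eq_coord_sub_pow_mul (hz₀ : ‖(z₀ : ℂ)‖ < 1) {f : diskAlgebra} (hf : f ≠ 0) :
    ∃ (m : ℕ) (h : diskAlgebra),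
      f = (coord - algebraMap ℂ diskAlgebra z₀) ^ m * h ∧ h.1 z₀ ≠ 0 := by
  obtain ⟨h, hfh, hdvd⟩ := (finiteMultiplicity_coord_sub hz₀ hf).exists_eq_pow_mul_and_not_dvd
  exact ⟨_, h, hfh, mt (coord_sub_dvd_iff hz₀).mpr hdvd⟩

section diagonalRep

variable {ι : Type*} [Fintype ι] [DecidableEq ι]

/-- The representation of the disk algebra by diagonal operators whose entries are the values at
the points `y i`; it sends `z` to the diagonal operator with entries `y i`. -/
def diagonalRep (y : ι → closedBall (0 : ℂ) 1) :
    diskAlgebra →ₐ[ℂ] (EuclideanSpace ℂ ι →L[ℂ] EuclideanSpace ℂ ι) :=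
  (Matrix.toEuclideanCLM (n := ι) (𝕜 := ℂ)).toAlgEquiv.toAlgHom.comp
    ((Matrix.diagonalAlgHom ℂ).comp
      (AlgHom.pi fun i => (ContinuousMap.evalAlgHom ℂ ℂ (y i)).comp diskAlgebra.val))

@[simp] theorem diagonalRep_apply (y : ι → closedBall (0 : ℂ) 1) (f : diskAlgebra)
    (v : EuclideanSpace ℂ ι) (i : ι) : diagonalRep y f v i = f.1 (y i) * v i :=
  Matrix.mulVec_diagonal (fun i => f.1 (y i)) v i

theorem norm_diagonalRep_le (y : ι → closedBall (0 : ℂ) 1) (f : diskAlgebra) :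
    ‖diagonalRep y f‖ ≤ ‖f‖ := by
  change ‖Matrix.toEuclideanCLM (n := ι) (𝕜 := ℂ) (Matrix.diagonal fun i => f.1 (y i))‖ ≤ ‖f‖
  rw [Matrix.l2_opNorm_toEuclideanCLM, Matrix.l2_opNorm_diagonal]
  exact (pi_norm_le_iff_of_nonneg (norm_nonneg f)).mpr fun i => f.1.norm_coe_le_norm _

end diagonalRep

end diskAlgebra

namespace FiniteBlaschke

variable (φ : FiniteBlaschke)

theorem norm_toFun_eq_one {z : ℂ} (hz : ‖z‖ = 1) : ‖φ.toFun z‖ = 1 := by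
  rw [toFun, norm_mul, φ.norm_u, one_mul, norm_prod]
  refine Finset.prod_eq_one fun i _ => ?_
  rw [norm_div, div_eq_one_iff_eq (norm_ne_zero_iff.mpr (denom_ne_zero (φ.norm_a_lt i) hz.le))]
  have hsq := normSq_identity (φ.a i) z
  rw [hz, one_pow, sub_self, mul_zero, sub_eq_zero] at hsq
  exact ((sq_eq_sq₀ (norm_nonneg _) (norm_nonneg _)).mp hsq).symm

theorem norm_selfMap_iterate_eq_one {ζ : closedBall (0 : ℂ) 1} (hζ : ‖(ζ : ℂ)‖ = 1) (j : ℕ) :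
    ‖(φ.selfMap^[j] ζ : ℂ)‖ = 1 := by
  induction j with
  | zero => exact hζ
  | succ j ih =>
    rw [Function.iterate_succ_apply']
    exact φ.norm_toFun_eq_one ih

theorem continuous_endo_pow (j : ℕ) :
    Continuous (φ.endo ^ j : diskAlgebra →ₐ[ℂ] diskAlgebra) := by
  rw [AlgHom.coe_pow]
  exact φ.continuous_endo.iterate j

theorem endo_pow_apply (j : ℕ) (f : diskAlgebra) (z : closedBall (0 : ℂ) 1) :
    ((φ.endo ^ j) f).1 z = f.1 (φ.selfMap^[j] z) := by
  induction j generalizing f with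
  | zero => rfl
  | succ j ih =>
    rw [pow_succ, AlgHom.mul_apply, ih, Function.iterate_succ_apply']
    rfl

theorem prod_endo_pow_apply {ι : Type*} (s : Finset ι) (j : ι → ℕ) (f : diskAlgebra)
    (z : closedBall (0 : ℂ) 1) :
    (∏ i ∈ s, (φ.endo ^ j i) f).1 z = ∏ i ∈ s, f.1 (φ.selfMap^[j i] z) := by
  rw [← Subalgebra.coe_val, map_prod, ContinuousMap.prod_apply]
  exact Finset.prod_congr rfl fun i _ => φ.endo_pow_apply _ f z

theorem prod_endo_pow_apply_of_fixed {z₀ : closedBall (0 : ℂ) 1} (hz₀ : φ.selfMap z₀ = z₀)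
    {ι : Type*} (s : Finset ι) (j : ι → ℕ) (f : diskAlgebra) :
    (∏ i ∈ s, (φ.endo ^ j i) f).1 z₀ = f.1 z₀ ^ s.card := by
  simp only [prod_endo_pow_apply, Function.iterate_fixed hz₀, Finset.prod_const]

theorem pow_card_le_norm_prod_endo_pow_apply {f : diskAlgebra} {δ : ℝ} (hδ : 0 ≤ δ)
    (hf : ∀ ζ : closedBall (0 : ℂ) 1, ‖(ζ : ℂ)‖ = 1 → δ ≤ ‖f.1 ζ‖) {ι : Type*} (s : Finset ι)
    (j : ι → ℕ) {ζ : closedBall (0 : ℂ) 1} (hζ : ‖(ζ : ℂ)‖ = 1) :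
    δ ^ s.card ≤ ‖(∏ i ∈ s, (φ.endo ^ j i) f).1 ζ‖ := by
  rw [prod_endo_pow_apply, norm_prod, ← Finset.prod_const]
  exact Finset.prod_le_prod (fun _ _ => hδ) fun i _ =>
    hf _ (φ.norm_selfMap_iterate_eq_one hζ (j i))

theorem IsElliptic.exists_pow_card_le_norm_prod_endo_pow {φ : FiniteBlaschke} (hφ : φ.IsElliptic)
    {f : diskAlgebra} (hf : f ≠ 0) :
    ∃ c : ℝ, 0 < c ∧ ∀ {ι : Type} (s : Finset ι) (j : ι → ℕ),
      c ^ s.card ≤ ‖∏ i ∈ s, (φ.endo ^ j i) f‖ := by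
  obtain ⟨w, hw, hfix⟩ := hφ
  let z₀ : closedBall (0 : ℂ) 1 := ⟨w, mem_closedBall_zero_iff.mpr hw.le⟩
  have hz₀ : φ.selfMap z₀ = z₀ := Subtype.ext hfix
  have hw' : 0 < 1 - ‖w‖ := sub_pos.mpr hw
  obtain ⟨m, h, rfl, hh⟩ := diskAlgebra.exists_eq_coord_sub_pow_mul (z₀ := z₀) hw hf
  have hcircle (ζ : closedBall (0 : ℂ) 1) (hζ : ‖(ζ : ℂ)‖ = 1) : (1 - ‖w‖) ^ m ≤
      ‖((diskAlgebra.coord - algebraMap ℂ diskAlgebra z₀) ^ m).1 ζ‖ := by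
    rw [diskAlgebra.coord_sub_pow_apply, norm_pow]
    exact pow_le_pow_left₀ hw'.le ((sub_le_sub_right hζ.ge _).trans (norm_sub_norm_le _ _)) m
  refine ⟨(1 - ‖w‖) ^ m * ‖h.1 z₀‖, mul_pos (pow_pos hw' m) (norm_pos_iff.mpr hh),
    fun s j => ?_⟩
  simp only [map_mul, Finset.prod_mul_distrib]
  rw [mul_pow, ← norm_pow, ← φ.prod_endo_pow_apply_of_fixed hz₀ s j h]
  exact diskAlgebra.mul_norm_apply_le_norm_mul
    (fun ζ hζ => φ.pow_card_le_norm_prod_endo_pow_apply (by positivity) hcircle s j hζ) _ z₀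

/-- The covariant pair on `ℂ ^ (k + 1)` in which `A` is diagonal, with entries the first `k + 1`
points of the orbit of `x`, and `T` is the shift. It recovers the values at `x` of the coefficients
of a formal polynomial. -/
def orbitPair (k : ℕ) (x : closedBall (0 : ℂ) 1) :
    CovariantPair φ (EuclideanSpace ℂ (Fin (k + 1))) where
  A := diskAlgebra.diagonalRep (fun i : Fin (k + 1) => φ.selfMap^[i] x) diskAlgebra.coord
  T := truncatedShift ℂ k
  norm_A_le := (diskAlgebra.norm_diagonalRep_le _ _).trans <|
    diskAlgebra.norm_le_of_forall zero_le_one fun z => mem_closedBall_zero_iff.mp z.2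
  norm_T_le := norm_truncatedShift_le
  ρ := diskAlgebra.diagonalRep fun i : Fin (k + 1) => φ.selfMap^[i] x
  norm_ρ_le := diskAlgebra.norm_diagonalRep_le _
  ρ_coord := rfl
  covariant := by
    ext v i
    simp only [mul_apply_eq_comp, diskAlgebra.diagonalRep_apply]
    cases i using Fin.cases with
    | zero => simp
    | succ i =>
      simp only [truncatedShift_apply_succ, diskAlgebra.diagonalRep_apply, Fin.val_succ,
        Fin.val_castSucc, Function.iterate_succ_apply']
      rfl

end FiniteBlaschke

/-- The pair `(A, r T)`, which is again covariant when `|r| ≤ 1`; it implements the substitution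
`U ↦ r U`. -/
def CovariantPair.scale {φ : FiniteBlaschke} {H : Type*} [NormedAddCommGroup H]
    [InnerProductSpace ℂ H] [CompleteSpace H] (R : CovariantPair φ H) (r : ℂ) (hr : ‖r‖ ≤ 1) :
    CovariantPair φ H where
  A := R.A
  T := r • R.T
  norm_A_le := R.norm_A_le
  norm_T_le := by
    rw [norm_smul]
    exact mul_le_one₀ hr (norm_nonneg _) R.norm_T_le
  ρ := R.ρ
  norm_ρ_le := R.norm_ρ_le
  ρ_coord := R.ρ_coord
  covariant := by rw [mul_smul_comm, smul_mul_assoc, R.covariant]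

namespace CovPoly

variable {φ : FiniteBlaschke}

theorem norm_mono_le (k : ℕ) (f : diskAlgebra) : ‖mono φ k f‖ ≤ ‖f‖ :=
  CovPoly.norm_le (norm_nonneg f) fun _ _ _ _ R => R.norm_rep_mono_le k f

theorem continuous_mono (k : ℕ) : Continuous (mono φ k) :=
  AddMonoidHomClass.continuous_of_bound (mono φ k) 1 fun f => by
    rw [one_mul]; exact norm_mono_le k f

/-- The coefficient `f_k` of `∑ U ^ k f_k`. -/
def coeff (φ : FiniteBlaschke) (k : ℕ) : CovPoly φ →+ diskAlgebra :=
  Finsupp.applyAddHom k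

theorem coeff_mono (k j : ℕ) (f : diskAlgebra) :
    coeff φ k (mono φ j f) = if j = k then f else 0 :=
  Finsupp.single_apply

theorem exists_eq_sum_mono_coeff (p : CovPoly φ) :
    ∃ s : Finset ℕ, p = ∑ k ∈ s, mono φ k (coeff φ k p) :=
  ⟨Finsupp.support p, (Finsupp.sum_single p).symm⟩

theorem coeff_mul (n : ℕ) (p q : CovPoly φ) :
    coeff φ n (p * q) =
      ∑ ij ∈ antidiagonal n, (φ.endo ^ ij.2) (coeff φ ij.1 p) * coeff φ ij.2 q := by
  induction p using CovPoly.induction with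
  | h0 => simp
  | hadd p₁ p₂ h₁ h₂ => simp [add_mul, h₁, h₂, Finset.sum_add_distrib]
  | hm i f =>
    induction q using CovPoly.induction with
    | h0 => simp
    | hadd q₁ q₂ h₁ h₂ => simp [mul_add, h₁, h₂, Finset.sum_add_distrib]
    | hm j g =>
      have hterm (ab : ℕ × ℕ) :
          (φ.endo ^ ab.2) (coeff φ ab.1 (mono φ i f)) * coeff φ ab.2 (mono φ j g) =
            if (i, j) = ab then (φ.endo ^ j) f * g else 0 := by
        rcases ab with ⟨a, b⟩
        rcases eq_or_ne i a with rfl | ha <;> rcases eq_or_ne j b with rfl | hb <;>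
          simp [coeff_mono, *]
      rw [mono_mul_mono, coeff_mono]
      simp only [hterm, Finset.sum_ite_eq, mem_antidiagonal]

theorem orbitPair_rep_single_zero_apply (k : ℕ) (x : closedBall (0 : ℂ) 1) (p : CovPoly φ)
    (i : Fin (k + 1)) :
    (φ.orbitPair k x).rep p (EuclideanSpace.single 0 1) i = (coeff φ i p).1 x := by
  induction p using CovPoly.induction with
  | h0 => simp
  | hadd p q hp hq => simp [hp, hq]
  | hm j f =>
    have hρ : (φ.orbitPair k x).ρ f (EuclideanSpace.single 0 1) =
        f.1 x • EuclideanSpace.single 0 1 := by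
      ext i
      change diskAlgebra.diagonalRep _ f _ i = _
      rcases eq_or_ne i 0 with rfl | hi <;> simp [*]
    rw [CovariantPair.rep_mono, coeff_mono, mul_apply_eq_comp, hρ, map_smul,
      PiLp.smul_apply]
    change f.1 x • ((truncatedShift ℂ k ^ j) (EuclideanSpace.single 0 1)) i = _
    rw [truncatedShift_pow_single_zero_apply]
    rcases eq_or_ne (i : ℕ) j with rfl | h
    · simp
    · simp [h, h.symm]

theorem norm_coeff_le (k : ℕ) (p : CovPoly φ) : ‖coeff φ k p‖ ≤ ‖p‖ := by
  refine diskAlgebra.norm_le_of_forall p.norm_nonneg' fun x => ?_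
  let R := φ.orbitPair k x
  calc ‖(coeff φ k p).1 x‖ = ‖R.rep p (EuclideanSpace.single 0 1) (Fin.last k)‖ := by
        rw [orbitPair_rep_single_zero_apply, Fin.val_last]
    _ ≤ ‖R.rep p (EuclideanSpace.single 0 1)‖ := PiLp.norm_apply_le _ _
    _ ≤ ‖R.rep p‖ := by
        simpa using (R.rep p).le_opNorm (EuclideanSpace.single 0 1)
    _ ≤ ‖p‖ := norm_rep_le p R

theorem continuous_coeff (k : ℕ) : Continuous (coeff φ k) :=
  AddMonoidHomClass.continuous_of_bound (coeff φ k) 1 fun p => by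
    rw [one_mul]; exact norm_coeff_le k p

/-- The substitution `U ↦ r U`, that is `∑ U ^ k f_k ↦ ∑ r ^ k U ^ k f_k`. For `|r| = 1` it is the
gauge action; `r ∈ [0, 1)` gives the Abel means. -/
def gauge (φ : FiniteBlaschke) (r : ℂ) : CovPoly φ →+ CovPoly φ :=
  lift fun k => (mono φ k).comp (DistribSMul.toAddMonoidHom diskAlgebra (r ^ k))

theorem gauge_mono (r : ℂ) (k : ℕ) (f : diskAlgebra) :
    gauge φ r (mono φ k f) = mono φ k (r ^ k • f) := by
  simp [gauge]

theorem gauge_one : gauge φ 1 = AddMonoidHom.id (CovPoly φ) :=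
  addHom_ext' fun k f => by simp [gauge_mono]

theorem continuous_gauge_apply (p : CovPoly φ) : Continuous fun r => gauge φ r p := by
  induction p using CovPoly.induction with
  | h0 => simpa using continuous_const
  | hadd p q hp hq =>
    simp only [map_add]
    exact hp.add hq
  | hm k f =>
    simp only [gauge_mono]
    exact (continuous_mono k).comp (by fun_prop)

theorem rep_gauge {H : Type*} [NormedAddCommGroup H] [InnerProductSpace ℂ H] [CompleteSpace H]
    (R : CovariantPair φ H) (r : ℂ) (hr : ‖r‖ ≤ 1) (p : CovPoly φ) :
    R.rep (gauge φ r p) = (R.scale r hr).rep p := by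
  induction p using CovPoly.induction with
  | h0 => simp
  | hadd p q hp hq => simp [hp, hq]
  | hm k f =>
    calc R.rep (gauge φ r (mono φ k f)) = R.T ^ k * R.ρ (r ^ k • f) := by
          rw [gauge_mono, CovariantPair.rep_mono]
      _ = (r • R.T) ^ k * R.ρ f := by rw [map_smul, mul_smul_comm, smul_pow, smul_mul_assoc]
      _ = (R.scale r hr).rep (mono φ k f) := ((R.scale r hr).rep_mono k f).symm

theorem norm_gauge_le {r : ℂ} (hr : ‖r‖ ≤ 1) (p : CovPoly φ) : ‖gauge φ r p‖ ≤ ‖p‖ :=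
  CovPoly.norm_le p.norm_nonneg' fun _ _ _ _ R => by
    rw [rep_gauge R r hr]
    exact norm_rep_le p _

theorem continuous_gauge {r : ℂ} (hr : ‖r‖ ≤ 1) : Continuous (gauge φ r) :=
  AddMonoidHomClass.continuous_of_bound (gauge φ r) 1 fun p => by
    rw [one_mul]; exact norm_gauge_le hr p

theorem norm_gauge_le_of_norm_coeff_le {r : ℂ} (hr : ‖r‖ < 1) {p : CovPoly φ} {C : ℝ}
    (hp : ∀ k, ‖coeff φ k p‖ ≤ C) : ‖gauge φ r p‖ ≤ C * (1 - ‖r‖)⁻¹ := by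
  have hC : 0 ≤ C := (norm_nonneg _).trans (hp 0)
  obtain ⟨s, hs⟩ := p.exists_eq_sum_mono_coeff
  have hterm (k : ℕ) : ‖gauge φ r (mono φ k (coeff φ k p))‖ ≤ C * ‖r‖ ^ k := by
    calc ‖gauge φ r (mono φ k (coeff φ k p))‖ ≤ ‖r ^ k • coeff φ k p‖ := by
          rw [gauge_mono]; exact norm_mono_le k _
      _ = ‖coeff φ k p‖ * ‖r‖ ^ k := by rw [norm_smul, norm_pow, mul_comm]
      _ ≤ C * ‖r‖ ^ k := by gcongr; exact hp k
  calc ‖gauge φ r p‖ = ‖∑ k ∈ s, gauge φ r (mono φ k (coeff φ k p))‖ := by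
        rw [← map_sum, ← hs]
    _ ≤ ∑ k ∈ s, C * ‖r‖ ^ k := norm_sum_le_of_le s fun k _ => hterm k
    _ = C * ∑ k ∈ s, ‖r‖ ^ k := by rw [Finset.mul_sum]
    _ ≤ C * ∑' k, ‖r‖ ^ k := by
        gcongr
        exact (summable_geometric_of_lt_one (norm_nonneg r) hr).sum_le_tsum s
          fun k _ => by positivity
    _ = C * (1 - ‖r‖)⁻¹ := by rw [tsum_geometric_of_lt_one (norm_nonneg r) hr]

end CovPoly

namespace SemicrossedProduct

variable {φ : FiniteBlaschke}

/-- The `k`-th Fourier coefficient of an element of the semicrossed product: the continuous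
extension of `∑ U ^ k f_k ↦ f_k`. -/
def coeff (φ : FiniteBlaschke) (k : ℕ) : SemicrossedProduct φ →+ diskAlgebra :=
  (CovPoly.coeff φ k).extension (CovPoly.continuous_coeff k)

theorem continuous_coeff (k : ℕ) : Continuous (coeff φ k) :=
  UniformSpace.Completion.continuous_extension

theorem coeff_coe (k : ℕ) (p : CovPoly φ) :
    coeff φ k (p : SemicrossedProduct φ) = CovPoly.coeff φ k p :=
  AddMonoidHom.extension_coe _ (CovPoly.continuous_coeff k) p

theorem norm_coeff_le (k : ℕ) (F : SemicrossedProduct φ) : ‖coeff φ k F‖ ≤ ‖F‖ := by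
  induction F using UniformSpace.Completion.induction_on with
  | hp => exact isClosed_le (continuous_coeff k).norm continuous_norm
  | ih p =>
    rw [coeff_coe, UniformSpace.Completion.norm_coe]
    exact CovPoly.norm_coeff_le k p

theorem coeff_one (k : ℕ) : coeff φ k 1 = if k = 0 then 1 else 0 := by
  rw [← UniformSpace.Completion.coe_one, coeff_coe, CovPoly.one_eq, CovPoly.coeff_mono]
  simp only [eq_comm]

theorem coeff_mul (n : ℕ) (F G : SemicrossedProduct φ) :
    coeff φ n (F * G) =
      ∑ ij ∈ antidiagonal n, (φ.endo ^ ij.2) (coeff φ ij.1 F) * coeff φ ij.2 G := by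
  induction F, G using UniformSpace.Completion.induction_on₂ with
  | hp =>
    refine isClosed_eq ((continuous_coeff n).comp continuous_mul)
      (continuous_finsetSum _ fun ij _ => ?_)
    exact ((φ.continuous_endo_pow ij.2).comp ((continuous_coeff ij.1).comp continuous_fst)).mul
      ((continuous_coeff ij.2).comp continuous_snd)
  | ih p q =>
    rw [← UniformSpace.Completion.coe_mul]
    simp only [coeff_coe, CovPoly.coeff_mul]

section LowestCoefficient

variable {F G : SemicrossedProduct φ} {a b : ℕ}

theorem coeff_mul_eq_zero_of_lt (hF : ∀ i < a, coeff φ i F = 0) (hG : ∀ j < b, coeff φ j G = 0)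
    {n : ℕ} (hn : n < a + b) : coeff φ n (F * G) = 0 := by
  rw [coeff_mul]
  refine Finset.sum_eq_zero fun ⟨i, j⟩ hij => ?_
  rw [mem_antidiagonal] at hij
  rcases lt_or_ge i a with hi | hi
  · simp [hF i hi]
  · simp [hG j (by lia)]

theorem coeff_add_mul (hF : ∀ i < a, coeff φ i F = 0) (hG : ∀ j < b, coeff φ j G = 0) :
    coeff φ (a + b) (F * G) = (φ.endo ^ b) (coeff φ a F) * coeff φ b G := by
  rw [coeff_mul, Finset.sum_eq_single_of_mem (a, b) (mem_antidiagonal.mpr rfl)]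
  rintro ⟨i, j⟩ hij hne
  rw [mem_antidiagonal] at hij
  rcases lt_or_ge i a with hi | hi
  · simp [hF i hi]
  · have hj : j < b := by
      by_contra! hj
      exact hne (by ext <;> dsimp only at hij ⊢ <;> lia)
    simp [hG j hj]

theorem coeff_pow_eq_zero_of_lt (hF : ∀ i < a, coeff φ i F = 0) (n : ℕ) :
    ∀ j < n * a, coeff φ j (F ^ n) = 0 := by
  induction n with
  | zero => simp
  | succ n ih =>
    intro j hj
    rw [pow_succ']
    exact coeff_mul_eq_zero_of_lt hF ih (by lia)

theorem coeff_mul_pow (hF : ∀ i < a, coeff φ i F = 0) (n : ℕ) :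
    coeff φ (n * a) (F ^ n) = ∏ i ∈ Finset.range n, (φ.endo ^ (i * a)) (coeff φ a F) := by
  induction n with
  | zero => simp [coeff_one]
  | succ n ih =>
    rw [pow_succ', Nat.succ_mul, add_comm, coeff_add_mul hF (coeff_pow_eq_zero_of_lt hF n), ih,
      Finset.prod_range_succ, mul_comm]

end LowestCoefficient

/-- The extension of `CovPoly.gauge` to the semicrossed product. It is contractive only for
`|r| ≤ 1`, hence the restriction of `r` to the closed disc. -/
def gauge (φ : FiniteBlaschke) (r : closedBall (0 : ℂ) 1) :
    SemicrossedProduct φ →+ SemicrossedProduct φ :=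
  (CovPoly.gauge φ r).completion (CovPoly.continuous_gauge (mem_closedBall_zero_iff.mp r.2))

theorem continuous_gauge (r : closedBall (0 : ℂ) 1) : Continuous (gauge φ r) :=
  AddMonoidHom.continuous_completion _ _

theorem gauge_coe (r : closedBall (0 : ℂ) 1) (p : CovPoly φ) :
    gauge φ r (p : SemicrossedProduct φ) = CovPoly.gauge φ r p :=
  AddMonoidHom.completion_coe _ _ p

theorem norm_gauge_le (r : closedBall (0 : ℂ) 1) (F : SemicrossedProduct φ) :
    ‖gauge φ r F‖ ≤ ‖F‖ := by
  induction F using UniformSpace.Completion.induction_on with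
  | hp => exact isClosed_le (continuous_gauge r).norm continuous_norm
  | ih p =>
    rw [gauge_coe, UniformSpace.Completion.norm_coe, UniformSpace.Completion.norm_coe]
    exact CovPoly.norm_gauge_le (mem_closedBall_zero_iff.mp r.2) p

theorem gauge_one (F : SemicrossedProduct φ) :
    gauge φ ⟨1, by simp⟩ F = F := by
  induction F using UniformSpace.Completion.induction_on with
  | hp => exact isClosed_eq (continuous_gauge _) continuous_id
  | ih p => rw [gauge_coe, CovPoly.gauge_one, AddMonoidHom.id_apply]

theorem continuous_gauge_apply (F : SemicrossedProduct φ) : Continuous fun r => gauge φ r F := by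
  have hjoint : Continuous fun Fr : SemicrossedProduct φ × closedBall (0 : ℂ) 1 =>
      gauge φ Fr.2 Fr.1 := by
    refine continuous_prod_of_dense_continuous_lipschitzWith _ (Real.toNNReal 1)
      UniformSpace.Completion.denseRange_coe ?_ fun r =>
        AddMonoidHomClass.lipschitz_of_bound (gauge φ r) 1 fun F => by
          rw [one_mul]; exact norm_gauge_le r F
    rintro _ ⟨p, rfl⟩
    simp only [gauge_coe]
    exact (UniformSpace.Completion.continuous_coe _).comp
      ((CovPoly.continuous_gauge_apply p).comp continuous_subtype_val)
  exact hjoint.curry_right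

/-- Quantifying over `G` makes this a closed condition, which can be checked on formal polynomials;
the case of interest is `G = F`. -/
theorem norm_gauge_le_of_coeff_eq_zero {F : SemicrossedProduct φ} (hF : ∀ k, coeff φ k F = 0)
    {r : closedBall (0 : ℂ) 1} (hr : ‖(r : ℂ)‖ < 1) (G : SemicrossedProduct φ) :
    ‖gauge φ r G‖ ≤ ‖G - F‖ * (1 - ‖(r : ℂ)‖)⁻¹ := by
  induction G using UniformSpace.Completion.induction_on with
  | hp =>
    exact isClosed_le (continuous_gauge r).norm
      ((continuous_id.sub continuous_const).norm.mul continuous_const)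
  | ih p =>
    rw [gauge_coe, UniformSpace.Completion.norm_coe]
    refine CovPoly.norm_gauge_le_of_norm_coeff_le hr fun k => ?_
    calc ‖CovPoly.coeff φ k p‖ = ‖coeff φ k (p - F)‖ := by
          rw [map_sub, hF, sub_zero, coeff_coe]
      _ ≤ ‖(p : SemicrossedProduct φ) - F‖ := norm_coeff_le k _

theorem gauge_eq_zero_of_coeff_eq_zero {F : SemicrossedProduct φ} (hF : ∀ k, coeff φ k F = 0)
    {r : closedBall (0 : ℂ) 1} (hr : ‖(r : ℂ)‖ < 1) : gauge φ r F = 0 := by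
  simpa using norm_gauge_le_of_coeff_eq_zero hF hr F

theorem eq_zero_of_coeff_eq_zero {F : SemicrossedProduct φ} (hF : ∀ k, coeff φ k F = 0) :
    F = 0 := by
  have hdense : Dense {r : closedBall (0 : ℂ) 1 | ‖(r : ℂ)‖ < 1} := by
    refine Subtype.dense_iff.mpr ((closure_ball (0 : ℂ) one_ne_zero).ge.trans (closure_mono ?_))
    exact fun r hr => ⟨⟨r, ball_subset_closedBall hr⟩, mem_ball_zero_iff.mp hr, rfl⟩
  have hgauge : (fun r => gauge φ r F) = fun _ => 0 :=
    (continuous_gauge_apply F).ext_on hdense continuous_const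
      fun _ hr => gauge_eq_zero_of_coeff_eq_zero hF hr
  rw [← gauge_one F]
  exact congrFun hgauge _

theorem exists_first_coeff_ne_zero {F : SemicrossedProduct φ} (hF : F ≠ 0) :
    ∃ k, coeff φ k F ≠ 0 ∧ ∀ j < k, coeff φ j F = 0 := by
  classical
  have hex : ∃ k, coeff φ k F ≠ 0 := by
    contrapose! hF
    exact eq_zero_of_coeff_eq_zero hF
  exact ⟨Nat.find hex, Nat.find_spec hex, fun j hj => not_not.mp (Nat.find_min hex hj)⟩

end SemicrossedProduct

end

theorem mainTheorem2_general (φ : FiniteBlaschke) (hφ : φ.IsElliptic) (F : SemicrossedProduct φ)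
    (hF : IsQuasinilpotent F) : F = 0 := by
  by_contra hF0
  obtain ⟨k, hk, hlow⟩ := SemicrossedProduct.exists_first_coeff_ne_zero hF0
  obtain ⟨c, hc, hle⟩ := hφ.exists_pow_card_le_norm_prod_endo_pow hk
  refine not_isQuasinilpotent_of_pow_le_norm_pow hc (fun n => ?_) hF
  calc c ^ n = c ^ (Finset.range n).card := by rw [Finset.card_range]
    _ ≤ ‖∏ i ∈ Finset.range n, (φ.endo ^ (i * k)) (SemicrossedProduct.coeff φ k F)‖ := hle _ _
    _ = ‖SemicrossedProduct.coeff φ (n * k) (F ^ n)‖ := by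
        rw [SemicrossedProduct.coeff_mul_pow hlow]
    _ ≤ ‖F ^ n‖ := SemicrossedProduct.norm_coeff_le _ _

theorem mainTheorem2 (φ : FiniteBlaschke) (hN : 1 < φ.N) (hφ : φ.IsElliptic)
    (F : SemicrossedProduct φ) (hF : IsQuasinilpotent F) : F = 0 :=
  mainTheorem2_general φ hφ F hF
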